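/- Let $(p_n)_{n\ge 1}$ be a strictly increasing sequence of odd primes with $\sum_{n\ge 1}\frac1{p_n}<\frac13$, and let $\beta>1$ be an irrational real number. Put $$A=\Big\{\tfrac1{p_{j_k}}+\sum_{i=1}^{\ell}\tfrac1{p_{j_i}}\ \Big|\ \ell\ge 1,\ 1\le k\le \ell,\ j_1<\dots<j_\ell\Big\},\qquad B=\Big\{\beta-\sum_{i=1}^{\ell}\tfrac1{p_i}\ \Big|\ \ell\ge 0\Big\},$$ and let $M$ be the additive submonoid of $\mathbb R$ generated by $A\cup B$. Then $M\subseteq\mathbb R_{\ge 0}$, the rank of $M$ (that is, the rank of its Grothendieck group as a $\mathbb Z$-module) is $2$, and, for every field $F$, the monoid algebra $F[M]$ is a weak-ACCP domain that does not satisfy the ascending chain condition on principal ideals (ACCP). Here an integral domain $R$ satisfies ACCP if every ascending chain of principal ideals of $R$ eventually stabilizes; an element $x\in R$ satisfies ACCP if every ascending chain of principal ideals of $R$ starting at $Rx$ eventually stabilizes; $R$ is atomic if every nonzero nonunit of $R$ is a product of irreducibles; and $R$ is a weak-ACCP domain if it is atomic and every nonempty finite subset $S$ of $R\setminus\{0\}$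 has a common divisor $d\in R$ such that $s/d$ satisfies ACCP for some $s\in S$. -/

import Mathlib

namespace WeakACCP

/-- An element `x` of a commutative ring satisfies ACCP if every ascending chain of principal
ideals starting at `(x)` stabilizes. -/
def ElementSatisfiesACCP {R : Type*} [CommRing R] (x : R) : Prop :=
  ∀ a : ℕ → R, Ideal.span {a 0} = Ideal.span {x} →
    (∀ n, Ideal.span {a n} ≤ Ideal.span {a (n + 1)}) →
    ∃ N, ∀ n, N ≤ n → Ideal.span {a n} = Ideal.span {a N}

/-- A commutative ring satisfies ACCP if every ascending chain of principal ideals stabilizes. -/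
def SatisfiesACCP (R : Type*) [CommRing R] : Prop :=
  ∀ a : ℕ → R, (∀ n, Ideal.span {a n} ≤ Ideal.span {a (n + 1)}) →
    ∃ N, ∀ n, N ≤ n → Ideal.span {a n} = Ideal.span {a N}

/-- Every nonzero nonunit is a (finite) product of irreducibles. -/
def IsAtomicRing (R : Type*) [CommRing R] : Prop :=
  ∀ x : R, x ≠ 0 → ¬ IsUnit x → ∃ s : Multiset R, (∀ a ∈ s, Irreducible a) ∧ s.prod = x

/-- A ring is a weak-ACCP domain if it is an atomic integral domain and every nonempty finite set
`S` of nonzero elements has a common divisor `d` such that `s / d` satisfies ACCP for some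
`s ∈ S`. -/
def IsWeakACCPDomain (R : Type*) [CommRing R] : Prop :=
  IsDomain R ∧ IsAtomicRing R ∧
    ∀ S : Finset R, S.Nonempty → (0 : R) ∉ S →
      ∃ d : R, (∀ s ∈ S, d ∣ s) ∧ ∃ s ∈ S, ∃ t : R, s = d * t ∧ ElementSatisfiesACCP t

/-- The rank of a commutative monoid: the rank of its Grothendieck group as a `ℤ`-module. -/
noncomputable def monoidRank (M : Type*) [AddCommMonoid M] : Cardinal :=
  Module.rank ℤ (Algebra.GrothendieckAddGroup M)

/-- The elements `1 / p k + ∑ j ∈ J, 1 / p j`, where `J` is a (nonempty) finite set of indices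
and `k ∈ J`. Sequences are indexed from `0`. -/
def setA (p : ℕ → ℕ) : Set ℝ :=
  {x | ∃ J : Finset ℕ, ∃ k ∈ J, x = 1 / (p k : ℝ) + ∑ j ∈ J, 1 / (p j : ℝ)}

/-- The elements `β - (1 / p 0 + ⋯ + 1 / p (l - 1))` for `l ≥ 0`; the case `l = 0` is `β`. -/
def setB (p : ℕ → ℕ) (β : ℝ) : Set ℝ :=
  {x | ∃ l : ℕ, x = β - ∑ i ∈ Finset.range l, 1 / (p i : ℝ)}

/-- The additive monoid generated by `A ∪ B`. -/
def monoidM (p : ℕ → ℕ) (β : ℝ) : AddSubmonoid ℝ :=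
  AddSubmonoid.closure (setA p ∪ setB p β)

end WeakACCP

namespace WeakACCP

/-! ### Accessibility for proper divisibility: ACCP and factorizations -/

section Accessible

variable {R : Type*} [CommRing R]

/-! Since `β` is irrational, `M` is graded by the coefficient of `β`: sums of elements of `A` have
degree 0, elements of `B` degree 1. Write `b_l` for the `l`-th element of `B`.

ACCP fails because `2 b_l = 2 b_(l+1) + 2 / p l` with `2 / p l` in `A`. A single `b_l` has no such
descent: `1 / p l` is not known to lie in `M`, and nonzero sums of elements of `A` use some
reciprocal twice. Comparing representations modulo each `p j` shows that degree-0 summands cannot be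
removed forever from an element of degree at most 1 (`wellFounded_degreeZeroStep`).

In the algebra, extreme exponents add under multiplication, so a polynomial whose minimal degree is
at most 1 has no infinite chain of proper divisors (`acc_dvdNotUnit`). Conversely `A` is rich enough
that two elements of `B` rewrite as `2 b_L` plus an element of `closure A`, for every large `L`.
Hence finitely many exponents of degree at least `n` share the summand `(n - 1) b_L`
(`exists_common_summand`). Dividing a finite set by the corresponding monomial leaves some quotient
of minimal degree at most 1, which gives weak ACCP. Atomicity is the singleton case, the monomial of
`b_L` being accessible too. -/

theorem elementSatisfiesACCP_of_acc [IsDomain R] {x : R} (hx0 : x ≠ 0)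
    (hx : Acc DvdNotUnit x) : ElementSatisfiesACCP x := by
  induction hx with
  | intro x _ ih =>
    intro a h0 ha
    have hdvd : ∀ n, a n ∣ x := by
      intro n
      rw [← Ideal.span_singleton_le_span_singleton, ← h0]
      exact monotone_nat_of_le_succ ha n.zero_le
    -- Either the chain never leaves `(x)`, or its tail starts at a proper divisor of `x`, where
    -- induction applies.
    by_cases hall : ∀ n, Ideal.span {a n} = Ideal.span {x}
    · exact ⟨0, fun n _ => (hall n).trans (hall 0).symm⟩
    · push Not at hall
      obtain ⟨m, hm⟩ := hall
      have hm' : DvdNotUnit (a m) x := by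
        refine dvdNotUnit_of_dvd_of_not_dvd (hdvd m) fun h => hm ?_
        exact le_antisymm (Ideal.span_singleton_le_span_singleton.2 h)
          (Ideal.span_singleton_le_span_singleton.2 (hdvd m))
      obtain ⟨N, hN⟩ := ih (a m) hm' (ne_zero_of_dvd_ne_zero hx0 (hdvd m))
        (fun n => a (m + n)) rfl (fun n => ha (m + n))
      refine ⟨m + N, fun n hn => ?_⟩
      have := hN (n - m) (by omega)
      rwa [show m + (n - m) = n by omega] at this

/-- The element `x` is a unit or a product of irreducibles. -/
def HasFactorization (x : R) : Prop :=
  IsUnit x ∨ ∃ s : Multiset R, (∀ a ∈ s, Irreducible a) ∧ s.prod = x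

theorem HasFactorization.unit_mul {u x : R} (hu : IsUnit u) (hx : HasFactorization x) :
    HasFactorization (u * x) := by
  rcases hx with hx | ⟨s, hs, rfl⟩
  · exact Or.inl (hu.mul hx)
  · induction s using Multiset.induction_on with
    | empty => exact Or.inl (by simpa using hu)
    | cons a s _ =>
      refine Or.inr ⟨(u * a) ::ₘ s, fun b hb => ?_, by simp [mul_assoc]⟩
      rcases Multiset.mem_cons.1 hb with rfl | hb
      · exact (irreducible_isUnit_mul hu).2 (hs a (Multiset.mem_cons_self a s))
      · exact hs b (Multiset.mem_cons_of_mem hb)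

theorem HasFactorization.mul {x y : R} (hx : HasFactorization x) (hy : HasFactorization y) :
    HasFactorization (x * y) := by
  rcases hx with hx | ⟨s, hs, rfl⟩
  · exact hy.unit_mul hx
  · rcases hy with hy | ⟨t, ht, rfl⟩
    · rw [mul_comm]
      exact HasFactorization.unit_mul hy (Or.inr ⟨s, hs, rfl⟩)
    · refine Or.inr ⟨s + t, fun a ha => ?_, by simp⟩
      exact (Multiset.mem_add.1 ha).elim (hs a) (ht a)

theorem HasFactorization.pow {x : R} (hx : HasFactorization x) (n : ℕ) :
    HasFactorization (x ^ n) := by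
  induction n with
  | zero => exact Or.inl (by simp)
  | succ n ih => rw [pow_succ]; exact ih.mul hx

theorem hasFactorization_of_acc [IsDomain R] {x : R} (hx0 : x ≠ 0) (hx : Acc DvdNotUnit x) :
    HasFactorization x := by
  induction hx with
  | intro x _ ih =>
    by_cases hu : IsUnit x
    · exact Or.inl hu
    by_cases hi : Irreducible x
    · exact Or.inr ⟨{x}, by simpa using hi, by simp⟩
    rw [irreducible_iff] at hi
    push Not at hi
    obtain ⟨a, b, rfl, ha, hb⟩ := hi hu
    have ha0 := left_ne_zero_of_mul hx0
    have hb0 := right_ne_zero_of_mul hx0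
    exact (ih a ⟨ha0, b, hb, rfl⟩ ha0).mul (ih b ⟨hb0, a, ha, mul_comm _ _⟩ hb0)

end Accessible

/-! ### Extreme exponents in monoid algebras -/

section TopExponent

open AddMonoidAlgebra

variable {F M Γ : Type*} [Field F] [AddCommMonoid M] [AddCommMonoid Γ] [LinearOrder Γ]

/-- The exponent `m` occurs in `f` and is maximal among those exponents with respect to `φ`. -/
def IsTopExponent (φ : M →+ Γ) (f : AddMonoidAlgebra F M) (m : M) : Prop :=
  m ∈ f.coeff.support ∧ ∀ m' ∈ f.coeff.support, φ m' ≤ φ m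

theorem exists_isTopExponent (φ : M →+ Γ) {f : AddMonoidAlgebra F M} (hf : f ≠ 0) :
    ∃ m, IsTopExponent φ f m := by
  apply Finset.exists_max_image
  rw [Finsupp.support_nonempty_iff]
  exact fun h => hf (by ext; simp [h])

theorem IsTopExponent.eq {φ : M →+ Γ} (hφ : Function.Injective φ) {f : AddMonoidAlgebra F M}
    {m n : M} (hm : IsTopExponent φ f m) (hn : IsTopExponent φ f n) : m = n :=
  hφ (le_antisymm (hn.2 m hm.1) (hm.2 n hn.1))

theorem isTopExponent_single (φ : M →+ Γ) (m : M) {c : F} (hc : c ≠ 0) :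
    IsTopExponent φ (single m c) m := by
  classical
  constructor
  · simp [hc]
  · intro m' h
    simp only [coeff_single, Finsupp.mem_support_iff, Finsupp.single_apply] at h
    by_cases h' : m = m'
    · rw [h']
    · simp [h'] at h

/-- The extreme pair is the only one with its sum, so the product of the two leading coefficients
cannot cancel. -/
theorem IsTopExponent.mul [IsOrderedCancelAddMonoid Γ] {φ : M →+ Γ} (hφ : Function.Injective φ)
    {f g : AddMonoidAlgebra F M} {m n : M}
    (hm : IsTopExponent φ f m) (hn : IsTopExponent φ g n) :
    IsTopExponent φ (f * g) (m + n) := by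
  classical
  constructor
  · have hu : UniqueAdd f.coeff.support g.coeff.support m n := by
      intro a b ha hb hab
      have h1 := hm.2 a ha
      have h2 := hn.2 b hb
      have h3 : φ a + φ b = φ m + φ n := by rw [← map_add, hab, map_add]
      obtain ⟨h4, h5⟩ := (add_eq_add_iff_eq_and_eq h1 h2).1 h3
      exact ⟨hφ h4, hφ h5⟩
    rw [Finsupp.mem_support_iff, coeff_mul_add_of_uniqueAdd hu]
    exact mul_ne_zero (Finsupp.mem_support_iff.1 hm.1) (Finsupp.mem_support_iff.1 hn.1)
  · intro k hk
    obtain ⟨a, ha, b, hb, rfl⟩ := Finset.mem_add.1 (support_coeff_mul_subset f g hk)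
    rw [map_add, map_add]
    exact add_le_add (hm.2 a ha) (hn.2 b hb)

theorem single_one_dvd {a : M} {f : AddMonoidAlgebra F M}
    (h : ∀ m ∈ f.coeff.support, ∃ m', m = a + m') : single a 1 ∣ f := by
  rw [← sum_coeff_single f]
  refine Finset.dvd_sum fun m hm => ?_
  obtain ⟨m', rfl⟩ := h m hm
  exact ⟨single m' (f.coeff (a + m')), by simp [single_mul_single]⟩

end TopExponent

end WeakACCP

namespace WeakACCP

/-! ### Divisibility in the algebra of a graded monoid of nonnegative reals -/

section GradedMonoid

open AddMonoidAlgebra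

variable {F M : Type*} [Field F] [AddCommMonoid M]

/-- The map `m ↦ (c * δ m, v m)` into the lexicographic product. -/
def lexHom (v : M →+ ℝ) (δ : M →+ ℕ) (c : ℤ) : M →+ ℤ ×ₗ ℝ where
  toFun m := toLex (c * δ m, v m)
  map_zero' := by simp
  map_add' a b := by rw [← toLex_add]; simp [mul_add]

theorem lexHom_injective {v : M →+ ℝ} (hv : Function.Injective v) (δ : M →+ ℕ) (c : ℤ) :
    Function.Injective (lexHom v δ c) := fun a b h => by
  have : (ofLex (lexHom v δ c a)).2 = (ofLex (lexHom v δ c b)).2 := by rw [h]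
  exact hv this

theorem lexHom_le {v : M →+ ℝ} {δ : M →+ ℕ} {c : ℤ} {a b : M}
    (h : lexHom v δ c a ≤ lexHom v δ c b) :
    c * δ a ≤ c * δ b ∧ (c * δ a = c * δ b → v a ≤ v b) := by
  simpa [lexHom] using Prod.Lex.toLex_le_toLex'.1 h

/-- `m` is of degree at most `1`, and arises from `m'` by adding a nonzero element of
degree `0`. -/
def DegreeZeroStep (δ : M →+ ℕ) (m' m : M) : Prop :=
  δ m ≤ 1 ∧ ∃ s, δ s = 0 ∧ s ≠ 0 ∧ m = m' + s

/-- The support lies in degree 0, and 0 has the largest value there. Values are nonnegative and `v`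
is injective, so only the constant term remains. -/
theorem isUnit_of_isTopExponent_zero {v : M →+ ℝ} (hv : Function.Injective v)
    (hv0 : ∀ m, 0 ≤ v m) {δ : M →+ ℕ} {h : AddMonoidAlgebra F M} {c : M}
    (h0 : IsTopExponent (lexHom v δ (-1)) h 0) (hc : IsTopExponent (lexHom v δ 1) h c)
    (hδ : δ c = 0) : IsUnit h := by
  have hsupp : ∀ m ∈ h.coeff.support, m = 0 := by
    intro m hm
    have h1 := (lexHom_le (hc.2 m hm)).1
    have h2 := (lexHom_le (h0.2 m hm)).2
    rw [hδ] at h1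
    have h3 : δ m = 0 := by
      simp only [one_mul, Nat.cast_zero, mul_zero] at h1
      omega
    have h4 := h2 (by simp [h3])
    rw [map_zero] at h4
    exact hv (by rw [map_zero]; exact le_antisymm h4 (hv0 m))
  have hh : h = single 0 (h.coeff 0) := by
    ext m
    rw [coeff_single]
    by_cases hm : m = 0
    · simp [hm]
    · rw [Finsupp.single_eq_of_ne hm]
      by_contra hne
      exact hm (hsupp m (Finsupp.mem_support_iff.2 hne))
  have hne : h.coeff 0 ≠ 0 := Finsupp.mem_support_iff.1 h0.1
  rw [hh]
  refine IsUnit.of_mul_eq_one (single 0 (h.coeff 0)⁻¹) ?_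
  rw [single_mul_single, mul_inv_cancel₀ hne, add_zero, one_def]

theorem acc_dvdNotUnit {v : M →+ ℝ} (hv : Function.Injective v)
    (hv0 : ∀ m, 0 ≤ v m) {δ : M →+ ℕ} (hwf : WellFounded (DegreeZeroStep δ))
    {f : AddMonoidAlgebra F M} {m : M} (hm : IsTopExponent (lexHom v δ (-1)) f m)
    (hδ : δ m ≤ 1) : Acc DvdNotUnit f := by
  have hf0 : ∀ {f : AddMonoidAlgebra F M} {m : M},
      IsTopExponent (lexHom v δ (-1)) f m → f ≠ 0 := by
    rintro f m h rfl
    simpa using h.1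
  -- The sign -1 selects the largest exponent of minimal degree (`m`), the sign 1 that of maximal
  -- degree (`m₂`). The induction is lexicographic: on the sum of these two degrees, then on `m`
  -- along `DegreeZeroStep`.
  suffices H : ∀ (N : ℕ) (m : M) (f : AddMonoidAlgebra F M) (m₂ : M),
      IsTopExponent (lexHom v δ (-1)) f m → IsTopExponent (lexHom v δ 1) f m₂ →
      δ m ≤ 1 → δ m + δ m₂ = N → Acc DvdNotUnit f by
    obtain ⟨m₂, hm₂⟩ := exists_isTopExponent (lexHom v δ 1) (hf0 hm)
    exact H _ m f m₂ hm hm₂ hδ rfl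
  intro N
  induction N using Nat.strong_induction_on with
  | _ N ihN =>
  intro m
  induction m using hwf.induction with
  | _ m ihm =>
  rintro f m₂ hm hm₂ hδ hN
  refine Acc.intro f ?_
  rintro g ⟨hg0, h, hh, rfl⟩
  have hh0 : h ≠ 0 := right_ne_zero_of_mul (hf0 hm)
  obtain ⟨a, ha⟩ := exists_isTopExponent (lexHom v δ (-1)) hg0
  obtain ⟨a₂, ha₂⟩ := exists_isTopExponent (lexHom v δ 1) hg0
  obtain ⟨c, hc⟩ := exists_isTopExponent (lexHom v δ (-1)) hh0
  obtain ⟨c₂, hc₂⟩ := exists_isTopExponent (lexHom v δ 1) hh0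
  obtain rfl := hm.eq (lexHom_injective hv δ _) (ha.mul (lexHom_injective hv δ _) hc)
  obtain rfl := hm₂.eq (lexHom_injective hv δ _) (ha₂.mul (lexHom_injective hv δ _) hc₂)
  simp only [map_add] at hδ hN
  -- If the cofactor `h` lives in degree 0, passing to `g` strips the nonzero degree-0 element `c`
  -- from `m`; otherwise the degree sum drops.
  by_cases h0 : δ c + δ c₂ = 0
  · have hc0 : c ≠ 0 := by
      rintro rfl
      exact hh (isUnit_of_isTopExponent_zero hv hv0 hc hc₂ (by omega))
    exact ihm a ⟨by simpa using hδ, c, by omega, hc0, rfl⟩ g a₂ ha ha₂ (by omega) (by omega)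
  · exact ihN (δ a + δ a₂) (by omega) a g a₂ ha ha₂ (by omega) rfl

theorem isWeakACCPDomain_addMonoidAlgebra [IsDomain (AddMonoidAlgebra F M)]
    {v : M →+ ℝ} (hv : Function.Injective v)
    (hv0 : ∀ m, 0 ≤ v m) {δ : M →+ ℕ} (hwf : WellFounded (DegreeZeroStep δ))
    (hdiv : ∀ (n : ℕ) (T : Finset M), (∀ m ∈ T, n ≤ δ m) →
      ∃ b : M, δ b = 1 ∧ ∀ m ∈ T, ∃ m', m = (n - 1) • b + m') :
    IsWeakACCPDomain (AddMonoidAlgebra F M) := by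
  classical
  have key : ∀ S : Finset (AddMonoidAlgebra F M), S.Nonempty → (0 : AddMonoidAlgebra F M) ∉ S →
      ∃ (b : M) (k : ℕ), δ b = 1 ∧ (∀ s ∈ S, (single b (1 : F)) ^ k ∣ s) ∧
        ∃ s ∈ S, ∃ t, s = (single b (1 : F)) ^ k * t ∧ t ≠ 0 ∧ Acc DvdNotUnit t := by
    intro S hS hS0
    have hne : ∀ s ∈ S, s ≠ 0 := fun s hs h => hS0 (h ▸ hs)
    have htop : ∀ s, ∃ m, s ∈ S → IsTopExponent (lexHom v δ (-1)) s m := by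
      intro s
      by_cases hs : s ∈ S
      · obtain ⟨m, hm⟩ := exists_isTopExponent (lexHom v δ (-1)) (hne s hs)
        exact ⟨m, fun _ => hm⟩
      · exact ⟨0, fun h => absurd h hs⟩
    choose E hE using htop
    -- The element of least minimal degree `n` is the one whose quotient satisfies ACCP: removing
    -- `(n - 1) • b` leaves minimal degree at most 1, also when `n = 0` and the subtraction
    -- truncates.
    obtain ⟨s, hs, hmin⟩ := Finset.exists_min_image S (fun s => δ (E s)) hS
    obtain ⟨b, hb, hbm⟩ := hdiv (δ (E s)) (S.biUnion fun s => s.coeff.support) (by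
      intro m hm
      obtain ⟨s', hs', hm⟩ := Finset.mem_biUnion.1 hm
      have h1 := (lexHom_le ((hE s' hs').2 m hm)).1
      have h2 := hmin s' hs'
      simp only [neg_mul, one_mul, neg_le_neg_iff, Nat.cast_le] at h1
      exact h2.trans h1)
    have hpow : (single b (1 : F)) ^ (δ (E s) - 1) = single ((δ (E s) - 1) • b) 1 := by
      rw [single_pow, one_pow]
    have hdvd : ∀ s' ∈ S, (single b (1 : F)) ^ (δ (E s) - 1) ∣ s' := by
      intro s' hs'
      rw [hpow]
      exact single_one_dvd fun m hm => hbm m (Finset.mem_biUnion.2 ⟨s', hs', hm⟩)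
    refine ⟨b, δ (E s) - 1, hb, hdvd, s, hs, ?_⟩
    obtain ⟨t, ht⟩ := hdvd s hs
    have ht0 : t ≠ 0 := by
      rintro rfl
      exact hne s hs (by rw [ht, mul_zero])
    obtain ⟨m, hm⟩ := exists_isTopExponent (lexHom v δ (-1)) ht0
    refine ⟨t, ht, ht0, acc_dvdNotUnit hv hv0 hwf hm ?_⟩
    have hmul := (isTopExponent_single (F := F) (lexHom v δ (-1)) ((δ (E s) - 1) • b)
      one_ne_zero).mul (lexHom_injective hv δ _) hm
    rw [← hpow, ← ht] at hmul
    have := congrArg δ ((hE s hs).eq (lexHom_injective hv δ _) hmul)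
    rw [map_add, map_nsmul, hb, smul_eq_mul, mul_one] at this
    omega
  refine ⟨inferInstance, ?_, ?_⟩
  · intro x hx hu
    obtain ⟨b, k, hb, -, s, hs, t, hst, ht0, ht⟩ :=
      key {x} (Finset.singleton_nonempty x) (by simpa using hx.symm)
    obtain rfl := Finset.mem_singleton.1 hs
    have hbacc : Acc DvdNotUnit (single b (1 : F)) :=
      acc_dvdNotUnit hv hv0 hwf (isTopExponent_single _ b one_ne_zero) hb.le
    have := ((hasFactorization_of_acc (by simp) hbacc).pow k).mul
      (hasFactorization_of_acc ht0 ht)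
    rw [← hst] at this
    exact this.resolve_left hu
  · intro S hS hS0
    obtain ⟨b, k, -, hdvd, s, hs, t, hst, ht0, ht⟩ := key S hS hS0
    exact ⟨_, hdvd, s, hs, t, hst, elementSatisfiesACCP_of_acc ht0 ht⟩

theorem not_satisfiesACCP_addMonoidAlgebra {v : M →+ ℝ} (hv : Function.Injective v)
    (hv0 : ∀ m, 0 ≤ v m) (u s : ℕ → M) (hs : ∀ n, s n ≠ 0) (hus : ∀ n, u n = u (n + 1) + s n) :
    ¬ SatisfiesACCP (AddMonoidAlgebra F M) := by
  intro H
  obtain ⟨N, hN⟩ := H (fun n => single (u n) 1) fun n => by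
    rw [Ideal.span_singleton_le_span_singleton]
    exact ⟨single (s n) 1, by rw [single_mul_single, ← hus, one_mul]⟩
  have h := hN (N + 1) N.le_succ
  have hd : single (u N) (1 : F) ∣ single (u (N + 1)) 1 :=
    Ideal.span_singleton_le_span_singleton.1 h.le
  obtain ⟨g, hg⟩ := hd
  have hg0 : g ≠ 0 := by
    rintro rfl
    rw [mul_zero, single_eq_zero] at hg
    exact one_ne_zero hg
  obtain ⟨m, hm⟩ := exists_isTopExponent v hg0
  have h1 := (isTopExponent_single (F := F) v (u N) one_ne_zero).mul hv hm
  rw [← hg] at h1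
  have h2 := congrArg v ((isTopExponent_single (F := F) v (u (N + 1)) one_ne_zero).eq hv h1)
  rw [hus N, map_add, map_add] at h2
  have h3 : v (s N) = 0 := by linarith [hv0 m, hv0 (s N)]
  exact hs N (hv (by rw [h3, map_zero]))

end GradedMonoid

end WeakACCP

namespace WeakACCP

/-! ### Arithmetic of sums of prime reciprocals -/

section Evaluation

/-- The value `∑ j, u j / p j`. -/
noncomputable def reciprocalSum (p : ℕ → ℕ) : (ℕ →₀ ℕ) →+ ℝ :=
  (Finsupp.linearCombination ℕ fun j => 1 / (p j : ℝ)).toAddMonoidHom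

theorem reciprocalSum_single (p : ℕ → ℕ) (j c : ℕ) :
    reciprocalSum p (Finsupp.single j c) = c * (1 / (p j : ℝ)) := by
  simp [reciprocalSum]

theorem reciprocalSum_eq_sum (p : ℕ → ℕ) (u : ℕ →₀ ℕ) {S : Finset ℕ} (hS : u.support ⊆ S) :
    reciprocalSum p u = ∑ j ∈ S, (u j : ℝ) * (1 / (p j : ℝ)) := by
  have : reciprocalSum p u = u.sum fun j c => (c : ℝ) * (1 / (p j : ℝ)) := by
    simp [reciprocalSum, Finsupp.linearCombination_apply]
  rw [this, Finsupp.sum_of_support_subset _ hS _ (by simp)]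

theorem sum_le_reciprocalSum (p : ℕ → ℕ) (u : ℕ →₀ ℕ) (T : Finset ℕ) :
    ∑ j ∈ T, (u j : ℝ) * (1 / (p j : ℝ)) ≤ reciprocalSum p u := by
  rw [reciprocalSum_eq_sum p u (Finset.subset_union_left (s₂ := T))]
  exact Finset.sum_le_sum_of_subset_of_nonneg Finset.subset_union_right
    fun _ _ _ => by positivity

theorem reciprocalSum_nonneg (p : ℕ → ℕ) (u : ℕ →₀ ℕ) : 0 ≤ reciprocalSum p u := by
  simpa using sum_le_reciprocalSum p u ∅

/-- After clearing denominators, every term except the `j`-th is divisible by `p j`, while the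
cofactor of `d j` is a product of other primes. -/
theorem dvd_of_sum_div_eq_zero {p : ℕ → ℕ} (hp : ∀ n, (p n).Prime) (hinj : Function.Injective p)
    {S : Finset ℕ} {d : ℕ → ℤ} (h : ∑ i ∈ S, (d i : ℝ) * (1 / (p i : ℝ)) = 0) {j : ℕ}
    (hj : j ∈ S) : (p j : ℤ) ∣ d j := by
  have hne : ∀ i, (p i : ℝ) ≠ 0 := fun i => Nat.cast_ne_zero.2 (hp i).ne_zero
  have h1 : ∑ i ∈ S, d i * ∏ k ∈ S.erase i, (p k : ℤ) = 0 := by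
    have h2 : ((∑ i ∈ S, d i * ∏ k ∈ S.erase i, (p k : ℤ) : ℤ) : ℝ) =
        (∏ k ∈ S, (p k : ℝ)) * ∑ i ∈ S, (d i : ℝ) * (1 / (p i : ℝ)) := by
      push_cast
      rw [Finset.mul_sum]
      refine Finset.sum_congr rfl fun i hi => ?_
      rw [← Finset.mul_prod_erase S (fun k => (p k : ℝ)) hi]
      field_simp [hne i]
    rw [h, mul_zero] at h2
    exact_mod_cast h2
  rw [← Finset.add_sum_erase S _ hj] at h1
  have h3 : (p j : ℤ) ∣ ∑ i ∈ S.erase j, d i * ∏ k ∈ S.erase i, (p k : ℤ) := by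
    refine Finset.dvd_sum fun i hi => Dvd.dvd.mul_left (Finset.dvd_prod_of_mem _ ?_) _
    exact Finset.mem_erase.2 ⟨(Finset.ne_of_mem_erase hi).symm, hj⟩
  have h4 : (p j : ℤ) ∣ d j * ∏ k ∈ S.erase j, (p k : ℤ) := (Int.dvd_add_left h3).1 (h1 ▸ dvd_zero _)
  have hpj : Prime (p j : ℤ) := Nat.prime_iff_prime_int.1 (hp j)
  refine (hpj.dvd_or_dvd h4).resolve_right fun h5 => ?_
  obtain ⟨k, hk, h6⟩ := (Prime.dvd_finsetProd_iff hpj _).1 h5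
  have h7 := (Nat.prime_dvd_prime_iff_eq (hp j) (hp k)).1 (Int.natCast_dvd_natCast.1 h6)
  exact Finset.ne_of_mem_erase hk (hinj h7).symm

theorem modEq_of_reciprocalSum_eq {p : ℕ → ℕ} (hp : ∀ n, (p n).Prime)
    (hinj : Function.Injective p) {u u' : ℕ →₀ ℕ}
    (h : reciprocalSum p u = reciprocalSum p u') (j : ℕ) : u j ≡ u' j [MOD p j] := by
  classical
  let S := insert j (u.support ∪ u'.support)
  have h1 : ∑ i ∈ S, (((u' i : ℤ) - (u i : ℤ) : ℤ) : ℝ) * (1 / (p i : ℝ)) = 0 := by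
    rw [reciprocalSum_eq_sum p u (S := S) (by intro; simp +contextual [S]),
      reciprocalSum_eq_sum p u' (S := S) (by intro; simp +contextual [S]), eq_comm,
      ← sub_eq_zero, ← Finset.sum_sub_distrib] at h
    rw [← h]
    refine Finset.sum_congr rfl fun i _ => ?_
    push_cast
    ring
  exact (Nat.modEq_iff_dvd).2
    (dvd_of_sum_div_eq_zero (d := fun i => (u' i : ℤ) - u i) hp hinj h1 (Finset.mem_insert_self _ _))

/-- The differences `w₀ - I₀` and `w - I` encode the start and the `n`-th term of a descending
chain, `v i` the summands removed. Their total value is bounded. If the doubled indices `k i` are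
bounded, each `v i` costs at least a fixed amount; if not, the congruences force arbitrarily many
indices to contribute at least 1 each. -/
theorem not_exists_reciprocalSum_chain {p : ℕ → ℕ} (hp : ∀ n, (p n).Prime) (hmono : StrictMono p)
    (w₀ I₀ : ℕ →₀ ℕ) (v : ℕ → ℕ →₀ ℕ) (hv : ∀ n, ∃ k, 2 ≤ v n k)
    (h : ∀ n, ∃ w I : ℕ →₀ ℕ, (∀ j, I j ≤ 1) ∧ reciprocalSum p I ≤ 1 ∧
      reciprocalSum p (w + ∑ i ∈ Finset.range n, v i + I₀) = reciprocalSum p (w₀ + I)) :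
    False := by
  classical
  have hppos : ∀ j, (0 : ℝ) < p j := fun j => Nat.cast_pos.2 (hp j).pos
  choose k hk using hv
  set X := reciprocalSum p w₀ + 1 with hX
  have hbound : ∀ n w I, reciprocalSum p I ≤ 1 →
      reciprocalSum p (w + ∑ i ∈ Finset.range n, v i + I₀) = reciprocalSum p (w₀ + I) →
      reciprocalSum p (w + ∑ i ∈ Finset.range n, v i) ≤ X := by
    intro n w I hI hw
    rw [map_add _ _ I₀, map_add _ w₀] at hw
    linarith [reciprocalSum_nonneg p I₀]
  by_cases hfin : (Set.range k).Finite
  · obtain ⟨K, hK⟩ := hfin.bddAbove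
    have hvi : ∀ i, 2 / (p K : ℝ) ≤ reciprocalSum p (v i) := by
      intro i
      have h1 := sum_le_reciprocalSum p (v i) {k i}
      rw [Finset.sum_singleton] at h1
      refine le_trans ?_ h1
      have h2 : (p (k i) : ℝ) ≤ p K :=
        Nat.cast_le.2 (hmono.monotone (hK (Set.mem_range_self i)))
      have h3 : (2 : ℝ) ≤ v i (k i) := by exact_mod_cast hk i
      rw [mul_one_div]
      exact div_le_div₀ (by linarith) h3 (hppos _) h2
    have hpos : 0 < 2 / (p K : ℝ) := by have := hppos K; positivity
    obtain ⟨n, hn⟩ := exists_nat_gt (X / (2 / (p K : ℝ)))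
    rw [div_lt_iff₀ hpos] at hn
    obtain ⟨w, I, -, hI, hw⟩ := h n
    have h1 := hbound n w I hI hw
    rw [map_add, map_sum] at h1
    have h2 : (n : ℝ) * (2 / (p K : ℝ)) ≤ ∑ i ∈ Finset.range n, reciprocalSum p (v i) := by
      have := Finset.card_nsmul_le_sum (Finset.range n) (fun i => reciprocalSum p (v i)) _
        fun i _ => hvi i
      simpa using this
    linarith [reciprocalSum_nonneg p w]
  -- Away from these supports the congruence modulo `p j` compares the coefficient on the left with
  -- `I j` alone, which is 0 or 1.
  · have hinf : (Set.range k \ ↑(w₀.support ∪ I₀.support)).Infinite :=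
      Set.Infinite.sdiff hfin (Finset.finite_toSet _)
    obtain ⟨N, hN⟩ := exists_nat_gt X
    obtain ⟨T, hT, hTN⟩ := hinf.exists_subset_card_eq N
    have hi : ∀ j, ∃ i, j ∈ T → k i = j := by
      intro j
      by_cases hj : j ∈ T
      · obtain ⟨i, hi⟩ := (hT hj).1
        exact ⟨i, fun _ => hi⟩
      · exact ⟨0, fun h => absurd h hj⟩
    choose i hi using hi
    obtain ⟨w, I, hI1, hI, hw⟩ := h (T.sup i + 1)
    have h1 := hbound _ w I hI hw
    refine absurd (le_trans (sum_le_reciprocalSum p _ T) h1) (not_le.2 ?_)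
    have hone : ∀ j ∈ T, (1 : ℝ) ≤
        ((w + ∑ i ∈ Finset.range (T.sup i + 1), v i) j : ℕ) * (1 / (p j : ℝ)) := by
      intro j hj
      have hmem := (hT hj).2
      simp only [Finset.coe_union, Set.mem_union, Finset.mem_coe, Finsupp.mem_support_iff,
        not_or, not_not] at hmem
      have hmod := modEq_of_reciprocalSum_eq hp hmono.injective hw j
      rw [Finsupp.add_apply _ I₀, Finsupp.add_apply w₀, hmem.1, hmem.2, add_zero, zero_add] at hmod
      set y := (w + ∑ i ∈ Finset.range (T.sup i + 1), v i) j with hy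
      have hy2 : 2 ≤ y := by
        have h2 : v (i j) j ≤ (∑ i ∈ Finset.range (T.sup i + 1), v i) j := by
          rw [Finsupp.finsetSum_apply]
          exact Finset.single_le_sum (f := fun i => v i j) (fun _ _ => Nat.zero_le _)
            (Finset.mem_range.2 (Nat.lt_succ_of_le (Finset.le_sup hj)))
        have h3 := hk (i j)
        rw [hi j hj] at h3
        rw [hy, Finsupp.add_apply]
        omega
      -- A coefficient at least 2 but congruent to 0 or 1 modulo `p j` is at least `p j`.
      have hy3 : p j ≤ y := by
        by_contra hlt
        have := Nat.ModEq.eq_of_lt_of_lt hmod (not_le.1 hlt)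
          (lt_of_le_of_lt (hI1 j) (hp j).one_lt)
        have := hI1 j
        omega
      rw [mul_one_div, le_div_iff₀ (hppos j), one_mul]
      exact_mod_cast hy3
    have h2 := Finset.card_nsmul_le_sum T _ _ hone
    rw [hTN] at h2
    refine lt_of_lt_of_le hN (le_trans (by simp) h2)

end Evaluation

end WeakACCP

namespace WeakACCP

/-! ### Normal forms, degree and descent in `M` -/

section Structure

variable {p : ℕ → ℕ} {β : ℝ}

/-- The generators `β - (1 / p 0 + ⋯ + 1 / p (l - 1))`. -/
noncomputable def genB (p : ℕ → ℕ) (β : ℝ) (l : ℕ) : ℝ :=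
  β - ∑ i ∈ Finset.range l, 1 / (p i : ℝ)

theorem genB_succ (p : ℕ → ℕ) (β : ℝ) (l : ℕ) :
    genB p β l = genB p β (l + 1) + 1 / (p l : ℝ) := by
  rw [genB, genB, Finset.sum_range_succ]
  ring

theorem genB_mem (p : ℕ → ℕ) (β : ℝ) (l : ℕ) : genB p β l ∈ monoidM p β :=
  AddSubmonoid.subset_closure (Or.inr ⟨l, rfl⟩)

theorem closure_setA_le : AddSubmonoid.closure (setA p) ≤ monoidM p β :=
  AddSubmonoid.closure_mono Set.subset_union_left

theorem two_mul_mem_closure_setA (p : ℕ → ℕ) (l : ℕ) :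
    2 * (1 / (p l : ℝ)) ∈ AddSubmonoid.closure (setA p) :=
  AddSubmonoid.subset_closure
    ⟨{l}, l, Finset.mem_singleton_self l, by rw [Finset.sum_singleton, two_mul]⟩

/-- For `L = l' + 1` the surplus is the sum of `1 / p j` over `l ≤ j ≤ l'` plus a second copy of `1
/ p l'`, exactly an element of `A`. Each further step adds `2 / p L`, again in `A`. -/
theorem genB_add_genB_of_le {l l' L : ℕ} (hl : l ≤ l') (hL : l' < L) :
    ∃ q ∈ AddSubmonoid.closure (setA p), genB p β l + genB p β l' = 2 * genB p β L + q := by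
  induction L, hL using Nat.le_induction with
  | base =>
    refine ⟨1 / (p l' : ℝ) + ∑ j ∈ Finset.Ico l (l' + 1), 1 / (p j : ℝ),
      AddSubmonoid.subset_closure ⟨_, l', Finset.mem_Ico.2 ⟨hl, l'.lt_succ_self⟩, rfl⟩, ?_⟩
    have h := Finset.sum_range_add_sum_Ico (fun j => 1 / (p j : ℝ)) (show l ≤ l' + 1 by omega)
    rw [genB_succ p β l']
    simp only [genB, ← h]
    ring
  | succ L _ ih =>
    obtain ⟨q, hq, h⟩ := ih
    refine ⟨q + 2 * (1 / (p L : ℝ)), add_mem hq (two_mul_mem_closure_setA p L), ?_⟩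
    rw [h, genB_succ p β L]
    ring

theorem genB_add_genB {l l' L : ℕ} (hl : l < L) (hl' : l' < L) :
    ∃ q ∈ AddSubmonoid.closure (setA p), genB p β l + genB p β l' = 2 * genB p β L + q := by
  rcases le_total l l' with h | h
  · exact genB_add_genB_of_le h hl'
  · rw [add_comm]
    exact genB_add_genB_of_le h hl

/-- `m` is, up to a sum of elements of `setA`, an even multiple of the generator `genB p β L`,
with at most one further generator of smaller index. -/
def IsReducedAt (p : ℕ → ℕ) (β : ℝ) (L : ℕ) (m : ℝ) : Prop :=
  ∃ k : ℕ, ∃ q ∈ AddSubmonoid.closure (setA p),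
    m = (2 * k : ℕ) * genB p β L + q ∨
      ∃ l < L, m = (2 * k : ℕ) * genB p β L + genB p β l + q

theorem IsReducedAt.add {L : ℕ} {m m' : ℝ} (hm : IsReducedAt p β L m)
    (hm' : IsReducedAt p β L m') : IsReducedAt p β L (m + m') := by
  obtain ⟨k, q, hq, h⟩ := hm
  obtain ⟨k', q', hq', h'⟩ := hm'
  rcases h with rfl | ⟨l, hl, rfl⟩ <;> rcases h' with rfl | ⟨l', hl', rfl⟩
  · exact ⟨k + k', q + q', add_mem hq hq', Or.inl (by push_cast; ring)⟩
  · exact ⟨k + k', q + q', add_mem hq hq', Or.inr ⟨l', hl', by push_cast; ring⟩⟩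
  · exact ⟨k + k', q + q', add_mem hq hq', Or.inr ⟨l, hl, by push_cast; ring⟩⟩
  -- Two leftover generators merge into one more pair at `L`.
  · obtain ⟨r, hr, h⟩ := genB_add_genB (p := p) (β := β) hl hl'
    refine ⟨k + k' + 1, q + q' + r, add_mem (add_mem hq hq') hr, Or.inl ?_⟩
    push_cast
    linear_combination h

theorem exists_forall_isReducedAt {m : ℝ} (hm : m ∈ monoidM p β) :
    ∃ L₀, ∀ L ≥ L₀, IsReducedAt p β L m := by
  induction hm using AddSubmonoid.closure_induction with
  | mem x hx =>
    rcases hx with hx | ⟨l, rfl⟩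
    · exact ⟨0, fun L _ => ⟨0, x, AddSubmonoid.subset_closure hx, Or.inl (by simp)⟩⟩
    · exact ⟨l + 1, fun L hL => ⟨0, 0, zero_mem _, Or.inr ⟨l, hL, by simp [genB]⟩⟩⟩
  | zero => exact ⟨0, fun L _ => ⟨0, 0, zero_mem _, Or.inl (by simp)⟩⟩
  | add x y _ _ hx hy =>
    obtain ⟨L₁, h₁⟩ := hx
    obtain ⟨L₂, h₂⟩ := hy
    exact ⟨max L₁ L₂, fun L hL => (h₁ L (le_trans (le_max_left _ _) hL)).add
      (h₂ L (le_trans (le_max_right _ _) hL))⟩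

theorem exists_rat_of_mem_closure_setA {q : ℝ} (hq : q ∈ AddSubmonoid.closure (setA p)) :
    ∃ r : ℚ, q = r := by
  induction hq using AddSubmonoid.closure_induction with
  | mem x hx =>
    obtain ⟨J, k, -, rfl⟩ := hx
    exact ⟨1 / (p k : ℚ) + ∑ j ∈ J, 1 / (p j : ℚ), by push_cast; rfl⟩
  | zero => exact ⟨0, by simp⟩
  | add x y _ _ hx hy =>
    obtain ⟨r, rfl⟩ := hx
    obtain ⟨s, rfl⟩ := hy
    exact ⟨r + s, by push_cast; rfl⟩

theorem exists_rat_genB (p : ℕ → ℕ) (β : ℝ) (l : ℕ) : ∃ r : ℚ, genB p β l = β + r :=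
  ⟨-∑ i ∈ Finset.range l, 1 / (p i : ℚ), by push_cast; rw [genB, sub_eq_add_neg]⟩

theorem exists_nat_mul_add_rat {m : ℝ} (hm : m ∈ monoidM p β) :
    ∃ n : ℕ, ∃ r : ℚ, m = n * β + r := by
  induction hm using AddSubmonoid.closure_induction with
  | mem x hx =>
    rcases hx with hx | ⟨l, rfl⟩
    · obtain ⟨r, hr⟩ := exists_rat_of_mem_closure_setA (AddSubmonoid.subset_closure hx)
      exact ⟨0, r, by simp [hr]⟩
    · obtain ⟨r, hr⟩ := exists_rat_genB p β l
      exact ⟨1, r, by rw [genB] at hr; rw [hr]; simp⟩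
  | zero => exact ⟨0, 0, by simp⟩
  | add x y _ _ hx hy =>
    obtain ⟨n, r, rfl⟩ := hx
    obtain ⟨n', s, rfl⟩ := hy
    exact ⟨n + n', r + s, by push_cast; ring⟩

theorem coeff_eq_of_irrational (hβ : Irrational β) {a b r s : ℚ}
    (h : a * β + r = b * β + s) : a = b := by
  by_contra hne
  refine hβ ⟨(s - r) / (a - b), ?_⟩
  have : (a : ℝ) - b ≠ 0 := sub_ne_zero.2 (by exact_mod_cast hne)
  push_cast
  rw [div_eq_iff this]
  linarith

/-- The degree of `m` is the number `n` with `m - n * β` rational. -/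
noncomputable def degree (p : ℕ → ℕ) (hβ : Irrational β) : monoidM p β →+ ℕ :=
  have hspec : ∀ m : monoidM p β, ∃ r : ℚ,
      (m : ℝ) = ((exists_nat_mul_add_rat m.2).choose : ℕ) * β + r :=
    fun m => (exists_nat_mul_add_rat m.2).choose_spec
  { toFun := fun m => (exists_nat_mul_add_rat m.2).choose
    map_zero' := by
      obtain ⟨r, hr⟩ := hspec 0
      have h0 : ((0 : monoidM p β) : ℝ) = 0 := rfl
      generalize (exists_nat_mul_add_rat (0 : monoidM p β).2).choose = a at *
      have := coeff_eq_of_irrational (a := 0) (b := a) (r := 0) (s := r) hβ (by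
        push_cast
        linarith)
      exact_mod_cast this.symm
    map_add' := fun m m' => by
      obtain ⟨r, hr⟩ := hspec (m + m')
      obtain ⟨s, hs⟩ := hspec m
      obtain ⟨t, ht⟩ := hspec m'
      have hadd : ((m + m' : monoidM p β) : ℝ) = m + m' := rfl
      generalize (exists_nat_mul_add_rat (m + m').2).choose = a at *
      generalize (exists_nat_mul_add_rat m.2).choose = b at *
      generalize (exists_nat_mul_add_rat m'.2).choose = c at *
      have := coeff_eq_of_irrational (a := a) (b := b + c) (r := r) (s := s + t) hβ (by
        push_cast
        linarith)
      exact_mod_cast this }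

theorem degree_spec (hβ : Irrational β) (m : monoidM p β) :
    ∃ r : ℚ, (m : ℝ) = degree p hβ m * β + r :=
  (exists_nat_mul_add_rat m.2).choose_spec

theorem degree_eq (hβ : Irrational β) {m : monoidM p β} {n : ℕ} {r : ℚ}
    (h : (m : ℝ) = n * β + r) : degree p hβ m = n := by
  obtain ⟨s, hs⟩ := degree_spec hβ m
  have := coeff_eq_of_irrational (a := degree p hβ m) (b := n) (r := s) (s := r) hβ (by
    push_cast
    linarith)
  exact_mod_cast this

theorem degree_genB (hβ : Irrational β) (l : ℕ) : degree p hβ ⟨genB p β l, genB_mem p β l⟩ = 1 := by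
  obtain ⟨r, hr⟩ := exists_rat_genB p β l
  exact degree_eq hβ (r := r) (by simpa using hr)

theorem exists_degree_eq_of_isReducedAt (hβ : Irrational β) {L : ℕ} {m : monoidM p β}
    (hm : IsReducedAt p β L m) : ∃ k : ℕ, ∃ q ∈ AddSubmonoid.closure (setA p),
      (degree p hβ m = 2 * k ∧ (m : ℝ) = (2 * k : ℕ) * genB p β L + q) ∨
      (degree p hβ m = 2 * k + 1 ∧
        ∃ l < L, (m : ℝ) = (2 * k : ℕ) * genB p β L + genB p β l + q) := by
  obtain ⟨k, q, hq, h⟩ := hm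
  refine ⟨k, q, hq, ?_⟩
  obtain ⟨r, hr⟩ := exists_rat_of_mem_closure_setA hq
  obtain ⟨s, hs⟩ := exists_rat_genB p β L
  rcases h with h | ⟨l, hl, h⟩
  · refine Or.inl ⟨degree_eq hβ (r := (2 * k : ℕ) * s + r) ?_, h⟩
    rw [h, hr, hs]
    push_cast
    ring
  · obtain ⟨t, ht⟩ := exists_rat_genB p β l
    refine Or.inr ⟨degree_eq hβ (r := (2 * k : ℕ) * s + t + r) ?_, l, hl, h⟩
    rw [h, hr, hs, ht]
    push_cast
    ring

theorem mem_closure_setA_of_degree_eq_zero (hβ : Irrational β) {m : monoidM p β}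
    (hm : degree p hβ m = 0) : (m : ℝ) ∈ AddSubmonoid.closure (setA p) := by
  obtain ⟨L₀, hL₀⟩ := exists_forall_isReducedAt m.2
  obtain ⟨k, q, hq, ⟨hk, h⟩ | ⟨hk, -⟩⟩ := exists_degree_eq_of_isReducedAt hβ (hL₀ L₀ le_rfl)
  · obtain rfl : k = 0 := by omega
    simpa [h] using hq
  · omega

theorem exists_eq_genB_add_of_degree_eq_one (hβ : Irrational β) {m : monoidM p β}
    (hm : degree p hβ m = 1) :
    ∃ l, ∃ q ∈ AddSubmonoid.closure (setA p), (m : ℝ) = genB p β l + q := by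
  obtain ⟨L₀, hL₀⟩ := exists_forall_isReducedAt m.2
  obtain ⟨k, q, hq, ⟨hk, -⟩ | ⟨hk, l, -, h⟩⟩ :=
    exists_degree_eq_of_isReducedAt hβ (hL₀ L₀ le_rfl)
  · omega
  · obtain rfl : k = 0 := by omega
    exact ⟨l, q, hq, by simpa using h⟩

theorem exists_common_summand (hβ : Irrational β) (n : ℕ) (T : Finset (monoidM p β))
    (hT : ∀ m ∈ T, n ≤ degree p hβ m) :
    ∃ b : monoidM p β, degree p hβ b = 1 ∧ ∀ m ∈ T, ∃ m', m = (n - 1) • b + m' := by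
  have hL₀ : ∀ m : monoidM p β, ∃ L₀, ∀ L ≥ L₀, IsReducedAt p β L (m : ℝ) :=
    fun m => exists_forall_isReducedAt m.2
  choose L₀ hL₀ using hL₀
  -- One index `L` past all thresholds. In the normal form at `L` the even multiplicity is the
  -- degree or one less, hence at least `n - 1`.
  set L := T.sup L₀
  refine ⟨⟨genB p β L, genB_mem p β L⟩, degree_genB hβ L, fun m hm => ?_⟩
  have hn := hT m hm
  obtain ⟨k, q, hq, ⟨hk, h⟩ | ⟨hk, l, -, h⟩⟩ :=
    exists_degree_eq_of_isReducedAt hβ (hL₀ m L (Finset.le_sup hm))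
  · obtain ⟨j, hj⟩ : ∃ j, 2 * k = (n - 1) + j := ⟨2 * k - (n - 1), by omega⟩
    refine ⟨⟨j • genB p β L + q,
      add_mem (nsmul_mem (genB_mem p β L) j) (closure_setA_le hq)⟩, Subtype.ext ?_⟩
    simp only [AddSubmonoid.coe_add, AddSubmonoidClass.coe_nsmul, nsmul_eq_mul]
    rw [h, hj]
    push_cast
    ring
  · obtain ⟨j, hj⟩ : ∃ j, 2 * k = (n - 1) + j := ⟨2 * k - (n - 1), by omega⟩
    refine ⟨⟨j • genB p β L + genB p β l + q,
      add_mem (add_mem (nsmul_mem (genB_mem p β L) j) (genB_mem p β l))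
        (closure_setA_le hq)⟩, Subtype.ext ?_⟩
    simp only [AddSubmonoid.coe_add, AddSubmonoidClass.coe_nsmul, nsmul_eq_mul]
    rw [h, hj]
    push_cast
    ring

/-- In each element of `A` the term `1 / p k` is counted twice, and multiplicities only grow under
addition. -/
theorem exists_reciprocalSum_of_mem_closure_setA {q : ℝ}
    (hq : q ∈ AddSubmonoid.closure (setA p)) :
    ∃ u : ℕ →₀ ℕ, q = reciprocalSum p u ∧ (q ≠ 0 → ∃ k, 2 ≤ u k) := by
  classical
  induction hq using AddSubmonoid.closure_induction with
  | mem x hx =>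
    obtain ⟨J, k, hk, rfl⟩ := hx
    refine ⟨Finsupp.single k 1 + ∑ j ∈ J, Finsupp.single j 1, ?_, fun _ => ⟨k, ?_⟩⟩
    · simp [map_add, map_sum, reciprocalSum_single]
    · have := Finset.single_le_sum (f := fun j => (Finsupp.single j 1 : ℕ →₀ ℕ) k)
        (fun _ _ => Nat.zero_le _) hk
      simp only [Finsupp.single_eq_same] at this
      rw [Finsupp.add_apply, Finsupp.finsetSum_apply, Finsupp.single_eq_same]
      omega
  | zero => exact ⟨0, by simp, fun h => absurd rfl h⟩
  | add x y _ _ hx hy =>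
    obtain ⟨u, rfl, hu⟩ := hx
    obtain ⟨u', rfl, hu'⟩ := hy
    refine ⟨u + u', (map_add _ _ _).symm, fun h => ?_⟩
    by_cases h0 : reciprocalSum p u = 0
    · obtain ⟨k, hk⟩ := hu' fun h1 => h (by rw [h0, h1, add_zero])
      exact ⟨k, by rw [Finsupp.add_apply]; omega⟩
    · obtain ⟨k, hk⟩ := hu h0
      exact ⟨k, by rw [Finsupp.add_apply]; omega⟩

theorem sum_le_one_third (hp_summable : Summable fun n => 1 / (p n : ℝ))
    (hp_sum : ∑' n, 1 / (p n : ℝ) < 1 / 3) (J : Finset ℕ) :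
    ∑ j ∈ J, 1 / (p j : ℝ) ≤ 1 / 3 :=
  (hp_summable.sum_le_tsum J fun _ _ => by positivity).trans hp_sum.le

/-- In degree 1 there is a single generator from `B`; moving the reciprocals it subtracts to the
left gives `I`, with multiplicities at most 1. -/
theorem exists_add_reciprocalSum_eq (hβ : Irrational β)
    (hp_summable : Summable fun n => 1 / (p n : ℝ)) (hp_sum : ∑' n, 1 / (p n : ℝ) < 1 / 3)
    {m : monoidM p β} (hm : degree p hβ m ≤ 1) :
    ∃ w I : ℕ →₀ ℕ, (∀ j, I j ≤ 1) ∧ reciprocalSum p I ≤ 1 ∧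
      (m : ℝ) + reciprocalSum p I = degree p hβ m * β + reciprocalSum p w := by
  classical
  rcases Nat.le_one_iff_eq_zero_or_eq_one.1 hm with h | h
  · obtain ⟨u, hu, -⟩ :=
      exists_reciprocalSum_of_mem_closure_setA (mem_closure_setA_of_degree_eq_zero hβ h)
    exact ⟨u, 0, by simp, by simp, by simp [h, hu]⟩
  · obtain ⟨l, q, hq, hm⟩ := exists_eq_genB_add_of_degree_eq_one hβ h
    obtain ⟨u, rfl, -⟩ := exists_reciprocalSum_of_mem_closure_setA hq
    have hval : reciprocalSum p (∑ i ∈ Finset.range l, Finsupp.single i 1) =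
        ∑ i ∈ Finset.range l, 1 / (p i : ℝ) := by
      simp [map_sum, reciprocalSum_single]
    refine ⟨u, ∑ i ∈ Finset.range l, Finsupp.single i 1, fun j => ?_, ?_, ?_⟩
    · rw [Finsupp.finsetSum_apply]
      simp only [Finsupp.single_apply, Finset.sum_ite_eq']
      split_ifs <;> simp
    · rw [hval]
      linarith [sum_le_one_third hp_summable hp_sum (Finset.range l)]
    · rw [hm, h, hval, genB]
      push_cast
      ring

theorem wellFounded_degreeZeroStep (hp_prime : ∀ n, (p n).Prime) (hp_mono : StrictMono p)
    (hβ : Irrational β) (hp_summable : Summable fun n => 1 / (p n : ℝ))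
    (hp_sum : ∑' n, 1 / (p n : ℝ) < 1 / 3) :
    WellFounded (DegreeZeroStep (degree p hβ)) := by
  rw [wellFounded_iff_isEmpty_descending_chain]
  refine ⟨fun ⟨f, hf⟩ => ?_⟩
  choose hdeg s hs0 hs hfs using hf
  have hu : ∀ n, ∃ u : ℕ →₀ ℕ, (s n : ℝ) = reciprocalSum p u ∧ ((s n : ℝ) ≠ 0 → ∃ k, 2 ≤ u k) :=
    fun n => exists_reciprocalSum_of_mem_closure_setA
      (mem_closure_setA_of_degree_eq_zero hβ (hs0 n))
  choose u hu hu2 using hu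
  have hsum : ∀ n, (f 0 : ℝ) = f n + reciprocalSum p (∑ i ∈ Finset.range n, u i) := by
    intro n
    induction n with
    | zero => simp
    | succ n ih =>
      rw [ih, hfs n, Finset.sum_range_succ, map_add, ← hu n, AddSubmonoid.coe_add]
      ring
  have hd : ∀ n, degree p hβ (f n) = degree p hβ (f 0) := by
    intro n
    induction n with
    | zero => rfl
    | succ n ih => rw [← ih, hfs n, map_add, hs0, add_zero]
  obtain ⟨w₀, I₀, -, -, h₀⟩ := exists_add_reciprocalSum_eq hβ hp_summable hp_sum (hdeg 0)
  refine not_exists_reciprocalSum_chain hp_prime hp_mono w₀ I₀ u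
    (fun n => hu2 n fun h => hs n (Subtype.ext h)) fun n => ?_
  obtain ⟨w, I, hI1, hI, h⟩ := exists_add_reciprocalSum_eq hβ hp_summable hp_sum (hdeg n)
  refine ⟨w, I, hI1, hI, ?_⟩
  rw [hd n] at h
  simp only [map_add]
  linarith [hsum n]

theorem nonneg_of_mem (hp_summable : Summable fun n => 1 / (p n : ℝ))
    (hp_sum : ∑' n, 1 / (p n : ℝ) < 1 / 3) (hβ : 1 < β) {x : ℝ} (hx : x ∈ monoidM p β) :
    0 ≤ x := by
  induction hx using AddSubmonoid.closure_induction with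
  | mem x hx =>
    rcases hx with ⟨J, k, -, rfl⟩ | ⟨l, rfl⟩
    · positivity
    · linarith [sum_le_one_third hp_summable hp_sum (Finset.range l)]
  | zero => exact le_rfl
  | add x y _ _ hx hy => exact add_nonneg hx hy

end Structure

/-! ### The rank of `M` -/

section Rank

variable {p : ℕ → ℕ} {β : ℝ}

theorem lift_subtype_injective (M : AddSubmonoid ℝ) :
    Function.Injective (Algebra.GrothendieckAddGroup.lift M.subtype) := by
  refine (AddSubmonoid.LocalizationMap.lift_injective_iff _ _).2 fun x y => ?_
  rw [M.subtype_injective.eq_iff]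
  exact Algebra.GrothendieckAddGroup.of_injective.eq_iff

theorem lift_subtype_of (M : AddSubmonoid ℝ) (m : M) :
    Algebra.GrothendieckAddGroup.lift M.subtype (Algebra.GrothendieckAddGroup.of m) = m :=
  DFunLike.congr_fun (Algebra.GrothendieckAddGroup.lift.symm_apply_apply M.subtype) m

theorem lift_subtype_mem_span (x : Algebra.GrothendieckAddGroup (monoidM p β)) :
    Algebra.GrothendieckAddGroup.lift (monoidM p β).subtype x ∈
      Submodule.span ℚ ({1, β} : Set ℝ) := by
  have hM : ∀ m : monoidM p β, (m : ℝ) ∈ Submodule.span ℚ ({1, β} : Set ℝ) := by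
    intro m
    obtain ⟨n, r, h⟩ := exists_nat_mul_add_rat m.2
    rw [h, Submodule.mem_span_pair]
    exact ⟨r, n, by simp [Rat.smul_def, add_comm]⟩
  rw [Algebra.GrothendieckAddGroup.lift_apply]
  exact sub_mem (hM _) (hM _)

/-- The Grothendieck group embeds in the `ℚ`-span of 1 and `β`, and already contains the independent
elements `2 / p 0` and `β`. -/
theorem monoidRank_monoidM (hp_prime : ∀ n, (p n).Prime) (hβ : Irrational β) :
    monoidRank (monoidM p β) = 2 := by
  set φ := Algebra.GrothendieckAddGroup.lift (monoidM p β).subtype with hφ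
  have hinj : Function.Injective φ := lift_subtype_injective _
  refine le_antisymm ?_ ?_
  · let V := Submodule.span ℚ ({1, β} : Set ℝ)
    let ψ : Algebra.GrothendieckAddGroup (monoidM p β) →ₗ[ℤ] V :=
      (φ.codRestrict V.toAddSubgroup lift_subtype_mem_span).toIntLinearMap
    have hψ : Function.Injective ψ := fun x y h => hinj (congrArg Subtype.val h)
    calc monoidRank (monoidM p β) ≤ Module.rank ℤ V := LinearMap.rank_le_of_injective ψ hψ
      _ = Module.rank ℚ V := (IsFractionRing.rank_right_eq ℤ ℚ V).symm
      _ ≤ Cardinal.mk ({1, β} : Set ℝ) := rank_span_le _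
      _ ≤ 2 := by
        refine (Cardinal.mk_insert_le).trans ?_
        rw [Cardinal.mk_singleton, one_add_one_eq_two]
  · let a : monoidM p β := ⟨2 * (1 / (p 0 : ℝ)), closure_setA_le (two_mul_mem_closure_setA p 0)⟩
    let b : monoidM p β := ⟨genB p β 0, genB_mem p β 0⟩
    have hli : LinearIndependent ℤ
        ![Algebra.GrothendieckAddGroup.of a, Algebra.GrothendieckAddGroup.of b] := by
      rw [LinearIndependent.pair_iff]
      intro s t h
      have h1 := congrArg φ h
      have ha : φ (Algebra.GrothendieckAddGroup.of a) = 2 * (1 / (p 0 : ℝ)) :=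
        lift_subtype_of _ a
      have hb : φ (Algebra.GrothendieckAddGroup.of b) = β :=
        (lift_subtype_of _ b).trans (by simp [b, genB])
      rw [map_add, map_zsmul, map_zsmul, ha, hb, map_zero, zsmul_eq_mul, zsmul_eq_mul] at h1
      have ht := coeff_eq_of_irrational (a := t) (b := 0) (r := s * (2 * (1 / (p 0 : ℚ))))
        (s := 0) hβ (by push_cast; linarith)
      have ht0 : t = 0 := by exact_mod_cast ht
      have hp0 : (0 : ℝ) < p 0 := Nat.cast_pos.2 (hp_prime 0).pos
      have h2 : 2 * (1 / (p 0 : ℝ)) ≠ 0 := by positivity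
      rw [ht0, Int.cast_zero, zero_mul, add_zero] at h1
      exact ⟨by exact_mod_cast (mul_eq_zero.1 h1).resolve_right h2, ht0⟩
    simpa [monoidRank] using hli.cardinal_lift_le_rank

end Rank

end WeakACCP

theorem mainTheorem2 (p : ℕ → ℕ) (hp_prime : ∀ n, (p n).Prime) (hp_odd : ∀ n, Odd (p n))
    (hp_mono : StrictMono p) (hp_summable : Summable fun n => 1 / (p n : ℝ))
    (hp_sum : ∑' n, 1 / (p n : ℝ) < 1 / 3)
    (β : ℝ) (hβ_irr : Irrational β) (hβ : 1 < β)
    (F : Type*) [Field F] :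
    (∀ x ∈ WeakACCP.monoidM p β, 0 ≤ x) ∧
      WeakACCP.monoidRank (WeakACCP.monoidM p β) = 2 ∧
      WeakACCP.IsWeakACCPDomain (AddMonoidAlgebra F (WeakACCP.monoidM p β)) ∧
      ¬ WeakACCP.SatisfiesACCP (AddMonoidAlgebra F (WeakACCP.monoidM p β)) := by
  have hnonneg : ∀ x ∈ WeakACCP.monoidM p β, 0 ≤ x :=
    fun x hx => WeakACCP.nonneg_of_mem hp_summable hp_sum hβ hx
  have hinj : Function.Injective (WeakACCP.monoidM p β).subtype := Subtype.val_injective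
  have hval : ∀ m, 0 ≤ (WeakACCP.monoidM p β).subtype m := fun m => hnonneg m m.2
  refine ⟨hnonneg, WeakACCP.monoidRank_monoidM hp_prime hβ_irr, ?_, ?_⟩
  · exact WeakACCP.isWeakACCPDomain_addMonoidAlgebra hinj hval
      (WeakACCP.wellFounded_degreeZeroStep hp_prime hp_mono hβ_irr hp_summable hp_sum)
      (WeakACCP.exists_common_summand hβ_irr)
  · refine WeakACCP.not_satisfiesACCP_addMonoidAlgebra hinj hval
      -- The factor 2 makes consecutive differences `2 / p n`, which lie in `A`.
      (fun n => 2 • ⟨WeakACCP.genB p β n, WeakACCP.genB_mem p β n⟩)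
      (fun n => ⟨2 * (1 / (p n : ℝ)),
        WeakACCP.closure_setA_le (WeakACCP.two_mul_mem_closure_setA p n)⟩)
      (fun n h => ?_) fun n => Subtype.ext ?_
    · have h1 : 2 * (1 / (p n : ℝ)) = 0 := congrArg Subtype.val h
      have h2 : (0 : ℝ) < p n := Nat.cast_pos.2 (hp_prime n).pos
      have h3 : 0 < 2 * (1 / (p n : ℝ)) := by positivity
      exact h3.ne' h1
    · simp only [AddSubmonoid.coe_add, AddSubmonoidClass.coe_nsmul, nsmul_eq_mul]
      push_cast
      linarith [WeakACCP.genB_succ p β n]
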